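/- Let $p>1$, let $f,g,\rho\in C[0,1]$ and $d\in C^1(0,1)$, and assume: $\rho>0$ in $(0,1)$ and $\rho(0)=\rho(1)=0$; $g(0)>0$ and $\int_0^u g(s)\,ds>0$ for every $u\in(0,1]$; $d>0$ in $(0,1)$ and $\rho\, d^{\frac1{p-1}}\in L^1(0,1)$. A traveling wave solution (t.w.s.) with speed $c\in\mathbb R$ of $f(u)u_x+g(u)u_\tau=[d(u)|u_x|^{p-2}u_x]_x+\rho(u)$ is a function $u\in C^1(\alpha,\beta)$, where $-\infty\le\alpha<\beta\le+\infty$, with $0<u(t)<1$ for every $t\in(\alpha,\beta)$ and $d(u)|u'|^{p-2}u'\in C^1(\alpha,\beta)$, such that $$(d(u)|u'|^{p-2}u')'+(cg(u)-f(u))u'+\rho(u)=0\quad\text{in }(\alpha,\beta),$$ $u(t)\to1$ as $t\to\alpha^+$, $u(t)\to0$ as $t\to\beta^-$, and $d(u(t))|u'(t)|^{p-2}u'(t)\to0$ both as $t\to\alpha^+$ and as $t\to\beta^-$. **Corollary 6.5.** Assume that $d(u)\sim k_1(1-u)^\delta$ and $\rho(u)\sim k_2(1-u)^r$ as $u\to1^-$,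 for some positive constants $k_1,k_2,r$ and some $\delta\in\mathbb R$ satisfying $r(p-1)+\delta+p>1$. Let $u$ be a t.w.s. with speed $c$, defined in $(\alpha,\beta)$. Then: (a) if $r(p-1)+\delta=1$, then $\alpha>-\infty$ if and only if $p+\delta>2$; (b) if $r(p-1)+\delta>1$ and $cg(1)<f(1)$, then $\alpha>-\infty$ if and only if $p+\delta>2$; (c) if $r(p-1)+\delta>1$ and $cg(1)>f(1)$, then $\alpha>-\infty$ if and only if $r<1$; (d) if $r(p-1)+\delta>1$, $cg(1)=f(1)$ and $r<1$, then $\alpha>-\infty$; (e) if $r(p-1)+\delta<1$, then $\alpha>-\infty$ if and only if $p+\delta>r+1$. Moreover, when $\alpha>-\infty$, writing $u'(\alpha^+)$ for $\lim_{t\to\alpha^+}u'(t)$: - if $\delta<1$, then $u'(\alpha^+)$ exists and equals $0$; - if $\delta=1$, then $u'(\alpha^+)$ exists and is finite, and $u'(\alpha^+)=0$ if and only if $cg(1)-f(1)\ge0$; - if $\delta>1$ and $cg(1)>f(1)$, then $u'(\alpha^+)$ exists and equals $0$; - if $\delta>1$ and $cg(1)<f(1)$, then $u'(\alpha^+)=-\infty$.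 -/

import Mathlib

open Filter Topology Asymptotics

/-- Standing assumptions on the coefficients of
`f(u) u_x + g(u) u_τ = [d(u) |u_x|^(p-2) u_x]_x + ρ(u)`. The coefficients are total functions on `ℝ`,
but only their values on `[0,1]` (on `(0,1)` for `d`) are constrained. -/
structure StructuralHypotheses (p : ℝ) (f g d ρ : ℝ → ℝ) : Prop where
  one_lt_p : 1 < p
  f_cont : ContinuousOn f (Set.Icc 0 1)
  g_cont : ContinuousOn g (Set.Icc 0 1)
  rho_cont : ContinuousOn ρ (Set.Icc 0 1)
  d_contDiff : ContDiffOn ℝ 1 d (Set.Ioo 0 1)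
  rho_pos : ∀ u ∈ Set.Ioo (0 : ℝ) 1, 0 < ρ u
  rho_zero : ρ 0 = 0
  rho_one : ρ 1 = 0
  g_zero_pos : 0 < g 0
  g_integral_pos : ∀ u ∈ Set.Ioc (0 : ℝ) 1, 0 < ∫ s in (0 : ℝ)..u, g s
  d_pos : ∀ u ∈ Set.Ioo (0 : ℝ) 1, 0 < d u
  rho_d_integrable :
    MeasureTheory.IntegrableOn (fun u => ρ u * d u ^ (1 / (p - 1))) (Set.Ioo 0 1)

/-- The open interval `(α, β) ⊆ ℝ` with possibly infinite endpoints. -/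
def openInterval (α β : EReal) : Set ℝ :=
  {t : ℝ | α < (t : EReal) ∧ (t : EReal) < β}

/-- The filter `t → α⁺` on `ℝ`: `t ↓ α` for real `α`, and `t → -∞` for `α = -∞`. -/
noncomputable def rightOf (α : EReal) : Filter ℝ :=
  comap (fun t : ℝ => (t : EReal)) (𝓝[>] α)

/-- The filter `t → β⁻` on `ℝ`: `t ↑ β` for real `β`, and `t → +∞` for `β = +∞`. -/
noncomputable def leftOf (β : EReal) : Filter ℝ :=
  comap (fun t : ℝ => (t : EReal)) (𝓝[<] β)

/-- The flux `t ↦ d(u(t)) |u'(t)|^(p-2) u'(t)`. For `p > 1` it vanishes wherever `u'(t) = 0`, also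
when `p < 2`. -/
noncomputable def pFlux (p : ℝ) (d u : ℝ → ℝ) (t : ℝ) : ℝ :=
  d (u t) * (|deriv u t| ^ (p - 2) * deriv u t)

/-- `u` is a travelling wave solution with speed `c`, defined in the interval `(α, β)`. -/
structure IsTravelingWave (p : ℝ) (f g d ρ : ℝ → ℝ) (c : ℝ) (α β : EReal) (u : ℝ → ℝ) :
    Prop where
  lt : α < β
  contDiff : ContDiffOn ℝ 1 u (openInterval α β)
  mem_Ioo : ∀ t ∈ openInterval α β, u t ∈ Set.Ioo (0 : ℝ) 1
  flux_contDiff : ContDiffOn ℝ 1 (pFlux p d u) (openInterval α β)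
  equation : ∀ t ∈ openInterval α β,
    deriv (pFlux p d u) t + (c * g (u t) - f (u t)) * deriv u t + ρ (u t) = 0
  tendsto_left : Tendsto u (rightOf α) (𝓝 1)
  tendsto_right : Tendsto u (leftOf β) (𝓝 0)
  flux_left : Tendsto (pFlux p d u) (rightOf α) (𝓝 0)
  flux_right : Tendsto (pFlux p d u) (leftOf β) (𝓝 0)

/-! Put `s = 1 - u`, `σ = s' = -u'`, `m = 1/(p-1)`, and let `v` be minus the flux. A wave is
strictly decreasing (`deriv_neg`), so `σ = (v/D)^m`, and along the orbit the equation reads `dv/ds =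
R (D/v)^m - H`, where `H` tends to `h₁ = c g(1) - f(1)`. The reaction term `R (D/v)^m` decreases in
`v`, so `v` can be compared with barriers `B s^a` although the equation is singular at `s = 0`.

Along a barrier, `dv/ds`, reaction and `H` have orders `s^(a-1)`, `s^(r+δm-am)` and at most `1`. For
`r + δm = m` take `a = 1`. For `r + δm < m` the first two balance at `a = (r+δm+1)/(m+1)` and `H` is
negligible. For `r + δm > m`, `H` balances `dv/ds` at `a = 1` if `h₁ < 0`, and the reaction at `a =
(r+δm)/m` if `h₁ > 0`.

If `v` is comparable to `s^a`, then `s'` is comparable to `s^((a-δ)m)`, so `s` vanishes at a finite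
time iff `(a-δ)m < 1` (`bot_lt_iff`). One-sided bounds on `v` also give the limit of `u'`, except
when `δ = 1`, which needs the exact limit of `v/s`. -/

section RightOf

variable {α : EReal}

theorem eventually_rightOf_iff (hα : α < ⊤) {P : ℝ → Prop} :
    (∀ᶠ t in rightOf α, P t) ↔
      ∃ t₁ : ℝ, α < t₁ ∧ ∀ t : ℝ, α < t → t ≤ t₁ → P t := by
  have hb := (nhdsGT_basis_of_exists_gt ⟨⊤, hα⟩).comap (fun t : ℝ => (t : EReal))
  rw [rightOf, hb.eventually_iff]
  constructor
  · rintro ⟨b, hb, h⟩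
    obtain ⟨x, hx₁, hx₂⟩ := EReal.lt_iff_exists_real_btwn.1 hb
    exact ⟨x, hx₁, fun t ht htx =>
      h ⟨ht, lt_of_le_of_lt (EReal.coe_le_coe_iff.2 htx) hx₂⟩⟩
  · rintro ⟨t₁, ht₁, h⟩
    exact ⟨t₁, ht₁, fun t ht => h t ht.1 (EReal.coe_le_coe_iff.1 ht.2.le)⟩

theorem le_of_hasDerivAt_nonneg {G G' : ℝ → ℝ} {x y : ℝ} (hxy : x ≤ y)
    (hG : ∀ t ∈ Set.Icc x y, HasDerivAt G (G' t) t) (h0 : ∀ t ∈ Set.Ioo x y, 0 ≤ G' t) :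
    G x ≤ G y := by
  refine monotoneOn_of_deriv_nonneg (convex_Icc x y)
    (fun t ht => (hG t ht).continuousAt.continuousWithinAt)
    (fun t ht => ?_) (fun t ht => ?_) (Set.left_mem_Icc.2 hxy) (Set.right_mem_Icc.2 hxy) hxy
  · exact (hG t (interior_subset ht)).differentiableAt.differentiableWithinAt
  · rw [(hG t (interior_subset ht)).deriv]
    rw [interior_Icc] at ht
    exact h0 t ht

/-- A function vanishing at `α⁺` that does not decrease where it is negative is nonnegative
near `α`. -/
theorem eventually_nonneg_of_deriv_nonneg_of_neg (hα : α < ⊤) {G G' : ℝ → ℝ}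
    (hlim : Tendsto G (rightOf α) (𝓝 0))
    (hG : ∀ᶠ t in rightOf α, HasDerivAt G (G' t) t)
    (hG' : ∀ᶠ t in rightOf α, G t < 0 → 0 ≤ G' t) :
    ∀ᶠ t in rightOf α, 0 ≤ G t := by
  obtain ⟨t₁, ht₁, h₁⟩ := (eventually_rightOf_iff hα).1 (hG.and hG')
  refine (eventually_rightOf_iff hα).2 ⟨t₁, ht₁, fun t₂ ht₂ ht₂₁ => ?_⟩
  by_contra! hneg
  have hev : ∀ᶠ t in rightOf α, G t₂ / 2 < G t :=
    hlim.eventually (eventually_gt_nhds (by linarith))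
  obtain ⟨t₃, ht₃, h₃⟩ := (eventually_rightOf_iff hα).1 hev
  set t := min t₃ t₂ with ht
  have htα : α < t := by
    rcases min_choice t₃ t₂ with h | h <;> rw [ht, h] <;> assumption
  have hGt := h₃ t htα (min_le_left _ _)
  have htt₂ : t ≤ t₂ := min_le_right _ _
  have hder : ∀ x ∈ Set.Icc t t₂, HasDerivAt G (G' x) x ∧ (G x < 0 → 0 ≤ G' x) := fun x hx =>
    h₁ x (htα.trans_le (EReal.coe_le_coe_iff.2 hx.1)) (hx.2.trans ht₂₁)
  have hcont : ContinuousOn G (Set.Icc t t₂) := fun x hx =>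
    (hder x hx).1.continuousAt.continuousWithinAt
  have hclosed : IsCompact (Set.Icc t t₂ ∩ G ⁻¹' Set.Ici (G t₂ / 2)) :=
    isCompact_Icc.of_isClosed_subset (hcont.preimage_isClosed_of_isClosed isClosed_Icc isClosed_Ici)
      Set.inter_subset_left
  -- `x₀` is the last point with `G ≥ G t₂ / 2`. After it `G` is negative, hence nondecreasing, so
  -- `G t₂ / 2 ≤ G x₀ ≤ G t₂ < 0`, which is absurd.
  obtain ⟨x₀, hx₀, hmax⟩ := hclosed.exists_isGreatest ⟨t, ⟨le_rfl, htt₂⟩, hGt.le⟩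
  have hle : G x₀ ≤ G t₂ := by
    refine le_of_hasDerivAt_nonneg hx₀.1.2
      (fun x hx => (hder x ⟨hx₀.1.1.trans hx.1, hx.2⟩).1)
      (fun x hx => (hder x ⟨hx₀.1.1.trans hx.1.le, hx.2.le⟩).2 ?_)
    by_contra! hx0
    exact absurd (hmax ⟨⟨hx₀.1.1.trans hx.1.le, hx.2.le⟩,
      show G t₂ / 2 ≤ G x by linarith⟩) (not_le.2 hx.1)
  have : G t₂ / 2 ≤ G x₀ := hx₀.2
  linarith

end RightOf

/-- The behaviour near `α` of `s = 1 - u` and of the (positive) flux `v`, where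
`s' = σ = (v / D) ^ m` and `v' = R - H σ`, with `D ∼ k₁ s ^ δ`, `R ∼ k₂ s ^ r`, `H → h₁`. -/
structure FluxSystem (α : EReal) (m δ r k₁ k₂ h₁ : ℝ) (s v σ D R H : ℝ → ℝ) : Prop where
  lt_top : α < ⊤
  m_pos : 0 < m
  k₁_pos : 0 < k₁
  k₂_pos : 0 < k₂
  r_pos : 0 < r
  s_pos : ∀ᶠ t in rightOf α, 0 < s t
  v_pos : ∀ᶠ t in rightOf α, 0 < v t
  D_pos : ∀ᶠ t in rightOf α, 0 < D t
  R_pos : ∀ᶠ t in rightOf α, 0 < R t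
  σ_eq : ∀ᶠ t in rightOf α, σ t = (v t / D t) ^ m
  s_deriv : ∀ᶠ t in rightOf α, HasDerivAt s (σ t) t
  v_deriv : ∀ᶠ t in rightOf α, HasDerivAt v (R t - H t * σ t) t
  s_lim : Tendsto s (rightOf α) (𝓝 0)
  v_lim : Tendsto v (rightOf α) (𝓝 0)
  H_lim : Tendsto H (rightOf α) (𝓝 h₁)
  D_lim : Tendsto (fun t => D t / s t ^ δ) (rightOf α) (𝓝 k₁)
  R_lim : Tendsto (fun t => R t / s t ^ r) (rightOf α) (𝓝 k₂)

/-! ### Power barriers for the flux -/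

namespace FluxSystem

variable {α : EReal} {m δ r k₁ k₂ h₁ : ℝ} {s v σ D R H : ℝ → ℝ}

theorem tendsto_rpow_zero (hF : FluxSystem α m δ r k₁ k₂ h₁ s v σ D R H) {a : ℝ} (ha : 0 < a) :
    Tendsto (fun t => s t ^ a) (rightOf α) (𝓝 0) := by
  simpa [Real.zero_rpow ha.ne'] using hF.s_lim.rpow_const (p := a) (Or.inr ha.le)

theorem tendsto_rpow_atTop (hF : FluxSystem α m δ r k₁ k₂ h₁ s v σ D R H) {a : ℝ} (ha : a < 0) :
    Tendsto (fun t => s t ^ a) (rightOf α) atTop := by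
  have h0 : Tendsto (fun t => s t ^ (-a)) (rightOf α) (𝓝[>] 0) :=
    tendsto_nhdsWithin_iff.2 ⟨hF.tendsto_rpow_zero (neg_pos.2 ha),
      hF.s_pos.mono fun t ht => Real.rpow_pos_of_pos ht _⟩
  refine h0.inv_tendsto_nhdsGT_zero.congr' (hF.s_pos.mono fun t ht => ?_)
  simp [Real.rpow_neg ht.le]

theorem barrier_hasDerivAt (hF : FluxSystem α m δ r k₁ k₂ h₁ s v σ D R H) (B a : ℝ) :
    ∀ᶠ t in rightOf α, HasDerivAt (fun t => v t - B * s t ^ a)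
      (R t - H t * σ t - B * (σ t * a * s t ^ (a - 1))) t := by
  filter_upwards [hF.s_pos, hF.s_deriv, hF.v_deriv] with t hs hs' hv'
  exact hv'.sub ((hs'.rpow_const (Or.inl hs.ne')).const_mul B)

theorem barrier_tendsto (hF : FluxSystem α m δ r k₁ k₂ h₁ s v σ D R H) (B : ℝ) {a : ℝ}
    (ha : 0 < a) : Tendsto (fun t => v t - B * s t ^ a) (rightOf α) (𝓝 0) := by
  simpa using hF.v_lim.sub ((hF.tendsto_rpow_zero ha).const_mul B)

/-- Wherever `v` lies below the barrier, the reaction `R / σ` is at least its value on the barrier,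
so `v - B s^a` increases there and cannot be negative near `α`. -/
theorem le_flux_of_subsolution (hF : FluxSystem α m δ r k₁ k₂ h₁ s v σ D R H) {B a : ℝ}
    (hB : 0 < B) (ha : 0 < a)
    (hsub : ∀ᶠ t in rightOf α,
      B * a * s t ^ (a - 1) + H t < R t * (D t / (B * s t ^ a)) ^ m) :
    ∀ᶠ t in rightOf α, B * s t ^ a ≤ v t := by
  have key := eventually_nonneg_of_deriv_nonneg_of_neg hF.lt_top (hF.barrier_tendsto B ha)
    (hF.barrier_hasDerivAt B a) ?_
  · exact key.mono fun t ht => sub_nonneg.1 ht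
  filter_upwards [hsub, hF.s_pos, hF.v_pos, hF.D_pos, hF.R_pos, hF.σ_eq]
    with t ht hs hv hD hR hσ hneg
  have hsa := Real.rpow_pos_of_pos hs a
  have hσ0 : 0 < σ t := by rw [hσ]; positivity
  -- The product equals `(v / (B s^a))^m`.
  have h1 : σ t * (D t / (B * s t ^ a)) ^ m ≤ 1 := by
    rw [hσ, ← Real.mul_rpow (by positivity) (by positivity)]
    refine Real.rpow_le_one (by positivity) ?_ hF.m_pos.le
    rw [div_mul_div_cancel₀ hD.ne', div_le_one (by positivity)]
    linarith
  have h2 := mul_le_mul_of_nonneg_left h1 hR.le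
  have h3 := mul_lt_mul_of_pos_left ht hσ0
  nlinarith

theorem flux_le_of_supersolution (hF : FluxSystem α m δ r k₁ k₂ h₁ s v σ D R H) {B a : ℝ}
    (hB : 0 < B) (ha : 0 < a)
    (hsup : ∀ᶠ t in rightOf α,
      R t * (D t / (B * s t ^ a)) ^ m < B * a * s t ^ (a - 1) + H t) :
    ∀ᶠ t in rightOf α, v t ≤ B * s t ^ a := by
  have hlim := (hF.barrier_tendsto B ha).neg
  rw [neg_zero] at hlim
  have key := eventually_nonneg_of_deriv_nonneg_of_neg hF.lt_top hlim
    ((hF.barrier_hasDerivAt B a).mono fun t ht => ht.neg) ?_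
  · exact key.mono fun t ht => by
      have : 0 ≤ -(v t - B * s t ^ a) := ht
      linarith
  filter_upwards [hsup, hF.s_pos, hF.v_pos, hF.D_pos, hF.R_pos, hF.σ_eq]
    with t ht hs hv hD hR hσ hneg
  have hneg' : -(v t - B * s t ^ a) < 0 := hneg
  have hsa := Real.rpow_pos_of_pos hs a
  have hσ0 : 0 < σ t := by rw [hσ]; positivity
  have h1 : 1 ≤ σ t * (D t / (B * s t ^ a)) ^ m := by
    rw [hσ, ← Real.mul_rpow (by positivity) (by positivity)]
    refine Real.one_le_rpow ?_ hF.m_pos.le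
    rw [div_mul_div_cancel₀ hD.ne', one_le_div (by positivity)]
    linarith
  have h2 := mul_le_mul_of_nonneg_left h1 hR.le
  have h3 := mul_lt_mul_of_pos_left ht hσ0
  nlinarith

/-- The reaction term along the barrier `B s ^ a`, rescaled by its power of `s`. -/
theorem tendsto_reaction (hF : FluxSystem α m δ r k₁ k₂ h₁ s v σ D R H) {B : ℝ} (hB : 0 < B)
    (a : ℝ) : Tendsto (fun t => R t * (D t / (B * s t ^ a)) ^ m * s t ^ (a * m - (r + δ * m)))
      (rightOf α) (𝓝 (k₂ * (k₁ / B) ^ m)) := by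
  have h := hF.R_lim.mul ((hF.D_lim.div_const B).rpow_const (p := m) (Or.inr hF.m_pos.le))
  refine h.congr' ?_
  filter_upwards [hF.s_pos, hF.D_pos] with t hs hD
  have e1 : D t / (B * s t ^ a) = D t / s t ^ δ / B * s t ^ (δ - a) := by
    rw [Real.rpow_sub hs]
    have := Real.rpow_pos_of_pos hs a
    have := Real.rpow_pos_of_pos hs δ
    field_simp
  have hsδ := Real.rpow_pos_of_pos hs δ
  have e2 : s t ^ ((δ - a) * m) * s t ^ (a * m - (r + δ * m)) = (s t ^ r)⁻¹ := by
    rw [← Real.rpow_add hs, ← Real.rpow_neg hs.le]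
    ring_nf
  rw [e1, Real.mul_rpow (by positivity) (Real.rpow_pos_of_pos hs _).le, ← Real.rpow_mul hs.le,
    div_eq_mul_inv (R t), ← e2]
  ring

theorem tendsto_const_rpow_atTop_small {c m : ℝ} (hc : 0 < c) (hm : 0 < m) :
    Tendsto (fun B : ℝ => (c / B) ^ m) (𝓝[>] 0) atTop :=
  (_root_.tendsto_rpow_atTop hm).comp (tendsto_inv_nhdsGT_zero.const_mul_atTop hc)

theorem tendsto_const_rpow_zero_large (c : ℝ) {m : ℝ} (hm : 0 < m) :
    Tendsto (fun B : ℝ => (c / B) ^ m) atTop (𝓝 0) := by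
  have h : Tendsto (fun B : ℝ => c / B) atTop (𝓝 0) := tendsto_const_nhds.div_atTop tendsto_id
  simpa [Real.zero_rpow hm.ne'] using h.rpow_const (p := m) (Or.inr hm.le)

/-- Linear flux for `r + δ m = m`. -/
theorem linear_bounds_of_eq (hF : FluxSystem α m δ r k₁ k₂ h₁ s v σ D R H) (he : r + δ * m = m) :
    (∃ B, 0 < B ∧ ∀ᶠ t in rightOf α, B * s t ^ (1 : ℝ) ≤ v t) ∧
      ∃ B, 0 < B ∧ ∀ᶠ t in rightOf α, v t ≤ B * s t ^ (1 : ℝ) := by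
  have hleft (B : ℝ) : Tendsto (fun t => B * 1 * s t ^ ((1 : ℝ) - 1) + H t) (rightOf α)
      (𝓝 (B + h₁)) := by simpa using hF.H_lim.const_add B
  have hright {B : ℝ} (hB : 0 < B) : Tendsto (fun t => R t * (D t / (B * s t ^ (1 : ℝ))) ^ m)
      (rightOf α) (𝓝 (k₂ * (k₁ / B) ^ m)) := by
    simpa [he] using hF.tendsto_reaction hB 1
  constructor
  · have h1 := (tendsto_const_rpow_atTop_small hF.k₁_pos hF.m_pos).const_mul_atTop hF.k₂_pos
    have h2 : ∀ᶠ B : ℝ in 𝓝[>] 0, B < 1 := nhdsWithin_le_nhds (eventually_lt_nhds one_pos)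
    -- With these bounds `B + h₁ < 1 + h₁ < k₂ (k₁/B)^m`; the upper barrier reverses both
    -- inequalities.
    obtain ⟨B, ⟨hB1, hB2⟩, hB0⟩ := ((h1.eventually_gt_atTop (1 + h₁)).and h2).and
      self_mem_nhdsWithin |>.exists
    exact ⟨B, hB0, hF.le_flux_of_subsolution hB0 one_pos
      ((hleft B).eventually_lt (hright hB0) (by linarith))⟩
  · have h1 := (tendsto_const_rpow_zero_large k₁ hF.m_pos).const_mul k₂
    rw [mul_zero] at h1
    obtain ⟨B, ⟨hB1, hB2⟩, hB0⟩ := ((h1.eventually (eventually_lt_nhds one_pos)).and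
      (eventually_gt_atTop (1 - h₁))).and (eventually_gt_atTop 0) |>.exists
    exact ⟨B, hB0, hF.flux_le_of_supersolution hB0 one_pos
      ((hright hB0).eventually_lt (hleft B) (by linarith))⟩

/-! ### Flux bounds when `r + δm > m` -/

section Supercritical

theorem tendsto_reaction_linear (hF : FluxSystem α m δ r k₁ k₂ h₁ s v σ D R H)
    (hlt : m < r + δ * m) {B : ℝ} (hB : 0 < B) :
    Tendsto (fun t => R t * (D t / (B * s t ^ (1 : ℝ))) ^ m) (rightOf α) (𝓝 0) := by
  have h := (hF.tendsto_reaction hB 1).mul (hF.tendsto_rpow_zero (sub_pos.2 hlt))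
  rw [mul_zero] at h
  refine h.congr' (hF.s_pos.mono fun t hs => ?_)
  rw [mul_assoc, ← Real.rpow_add hs]
  simp

theorem flux_le_linear (hF : FluxSystem α m δ r k₁ k₂ h₁ s v σ D R H)
    (hlt : m < r + δ * m) {B : ℝ} (hB : 0 < B) (hBh : -h₁ < B) :
    ∀ᶠ t in rightOf α, v t ≤ B * s t ^ (1 : ℝ) := by
  refine hF.flux_le_of_supersolution hB one_pos
    ((hF.tendsto_reaction_linear hlt hB).eventually_lt (z := h₁ + B) ?_ (by linarith))
  simpa [add_comm B] using hF.H_lim.const_add B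

theorem linear_le_flux (hF : FluxSystem α m δ r k₁ k₂ h₁ s v σ D R H)
    (hlt : m < r + δ * m) {B : ℝ} (hB : 0 < B) (hBh : B < -h₁) :
    ∀ᶠ t in rightOf α, B * s t ^ (1 : ℝ) ≤ v t := by
  refine hF.le_flux_of_subsolution hB one_pos
    (Tendsto.eventually_lt (y := B + h₁) ?_ (hF.tendsto_reaction_linear hlt hB) (by linarith))
  simpa using hF.H_lim.const_add B

/-- Slope of the flux for `r + δ m > m`. -/
theorem tendsto_flux_div (hF : FluxSystem α m δ r k₁ k₂ h₁ s v σ D R H) (hlt : m < r + δ * m) :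
    Tendsto (fun t => v t / s t) (rightOf α) (𝓝 (max (-h₁) 0)) := by
  refine tendsto_order.2 ⟨fun b hb => ?_, fun b hb => ?_⟩
  · by_cases hb0 : b < 0
    · filter_upwards [hF.s_pos, hF.v_pos] with t hs hv
      exact hb0.trans (by positivity)
    · have hb' : b < -h₁ := (lt_max_iff.1 hb).resolve_right hb0
      filter_upwards [hF.s_pos, hF.linear_le_flux hlt (B := (b + -h₁) / 2)
        (by linarith) (by linarith)] with t hs hv
      rw [Real.rpow_one] at hv
      rw [lt_div_iff₀ hs]
      nlinarith
  · obtain ⟨c, hc, hcb⟩ := exists_between hb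
    filter_upwards [hF.s_pos, hF.flux_le_linear hlt (B := c)
      ((le_max_right _ _).trans_lt hc) ((le_max_left _ _).trans_lt hc)] with t hs hv
    rw [Real.rpow_one] at hv
    rw [div_lt_iff₀ hs]
    nlinarith

theorem tendsto_barrier_balance (hF : FluxSystem α m δ r k₁ k₂ h₁ s v σ D R H)
    (hlt : m < r + δ * m) (B : ℝ) :
    Tendsto (fun t => B * ((r + δ * m) / m) * s t ^ ((r + δ * m) / m - 1) + H t) (rightOf α)
      (𝓝 h₁) := by
  have h := ((hF.tendsto_rpow_zero (a := (r + δ * m) / m - 1)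
    (sub_pos.2 ((one_lt_div hF.m_pos).2 hlt))).const_mul (B * ((r + δ * m) / m))).add hF.H_lim
  simpa using h

theorem tendsto_reaction_balance (hF : FluxSystem α m δ r k₁ k₂ h₁ s v σ D R H) {B : ℝ}
    (hB : 0 < B) : Tendsto (fun t => R t * (D t / (B * s t ^ ((r + δ * m) / m))) ^ m)
      (rightOf α) (𝓝 (k₂ * (k₁ / B) ^ m)) := by
  have h := hF.tendsto_reaction hB ((r + δ * m) / m)
  simpa only [div_mul_cancel₀ _ hF.m_pos.ne', sub_self, Real.rpow_zero, mul_one] using h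

/-- At this exponent the reaction has order one and the barrier's slope vanishes in the limit, so
only `h₁ < k₂ (k₁/B)^m` is needed: a small `B` works for any sign of `h₁`. -/
theorem balance_le_flux (hF : FluxSystem α m δ r k₁ k₂ h₁ s v σ D R H) (hlt : m < r + δ * m) :
    ∃ B, 0 < B ∧ ∀ᶠ t in rightOf α, B * s t ^ ((r + δ * m) / m) ≤ v t := by
  have h1 := (tendsto_const_rpow_atTop_small hF.k₁_pos hF.m_pos).const_mul_atTop hF.k₂_pos
  obtain ⟨B, hB1, hB0⟩ := ((h1.eventually_gt_atTop h₁).and self_mem_nhdsWithin).exists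
  exact ⟨B, hB0, hF.le_flux_of_subsolution hB0 (div_pos (hF.m_pos.trans hlt) hF.m_pos)
    ((hF.tendsto_barrier_balance hlt B).eventually_lt (hF.tendsto_reaction_balance hB0) hB1)⟩

theorem flux_le_balance (hF : FluxSystem α m δ r k₁ k₂ h₁ s v σ D R H) (hlt : m < r + δ * m)
    (hh : 0 < h₁) : ∃ B, 0 < B ∧ ∀ᶠ t in rightOf α, v t ≤ B * s t ^ ((r + δ * m) / m) := by
  have h1 := (tendsto_const_rpow_zero_large k₁ hF.m_pos).const_mul k₂
  rw [mul_zero] at h1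
  obtain ⟨B, hB1, hB0⟩ := ((h1.eventually (eventually_lt_nhds hh)).and
    (eventually_gt_atTop 0)).exists
  exact ⟨B, hB0, hF.flux_le_of_supersolution hB0 (div_pos (hF.m_pos.trans hlt) hF.m_pos)
    ((hF.tendsto_reaction_balance hB0).eventually_lt (hF.tendsto_barrier_balance hlt B) hB1)⟩

end Supercritical

/-! ### Flux bounds when `r + δm < m` -/

section Subcritical

theorem sublinear_bounds (hF : FluxSystem α m δ r k₁ k₂ h₁ s v σ D R H)
    (hgt : r + δ * m < m) (hneg : -1 < r + δ * m) :
    (∃ B, 0 < B ∧ ∀ᶠ t in rightOf α, B * s t ^ ((r + δ * m + 1) / (m + 1)) ≤ v t) ∧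
      ∃ B, 0 < B ∧ ∀ᶠ t in rightOf α, v t ≤ B * s t ^ ((r + δ * m + 1) / (m + 1)) := by
  have hm := hF.m_pos
  obtain ⟨a, ha⟩ : ∃ a, a = (r + δ * m + 1) / (m + 1) := ⟨_, rfl⟩
  rw [← ha]
  have ha0 : 0 < a := by rw [ha]; exact div_pos (by linarith) (by linarith)
  have ha1 : a < 1 := by rw [ha, div_lt_one (by linarith)]; linarith
  have hae : a * m - (r + δ * m) = 1 - a := by rw [ha]; field_simp; ring
  -- Slope and reaction both blow up like `s^(a-1)`; after rescaling by `s^(1-a)` they have finite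
  -- limits and `H` disappears.
  have hleft (B : ℝ) : Tendsto (fun t => (B * a * s t ^ (a - 1) + H t) * s t ^ (1 - a))
      (rightOf α) (𝓝 (B * a)) := by
    have h := (hF.H_lim.mul (hF.tendsto_rpow_zero (sub_pos.2 ha1))).const_add (B * a)
    rw [mul_zero, add_zero] at h
    refine h.congr' (hF.s_pos.mono fun t hs => ?_)
    beta_reduce
    rw [add_mul, mul_assoc (B * a), ← Real.rpow_add hs]
    simp
  have hright {B : ℝ} (hB : 0 < B) : Tendsto (fun t => R t * (D t / (B * s t ^ a)) ^ m *
      s t ^ (1 - a)) (rightOf α) (𝓝 (k₂ * (k₁ / B) ^ m)) := by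
    have h := hF.tendsto_reaction hB a
    rwa [hae] at h
  constructor
  · have h1 := (tendsto_const_rpow_atTop_small hF.k₁_pos hF.m_pos).const_mul_atTop hF.k₂_pos
    have h2 : ∀ᶠ B : ℝ in 𝓝[>] 0, B < 1 := nhdsWithin_le_nhds (eventually_lt_nhds one_pos)
    obtain ⟨B, ⟨hB1, hB2⟩, hB0⟩ := ((h1.eventually_gt_atTop 1).and h2).and
      self_mem_nhdsWithin |>.exists
    refine ⟨B, hB0, hF.le_flux_of_subsolution hB0 ha0 ?_⟩
    filter_upwards [hF.s_pos, (hleft B).eventually_lt (hright hB0)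
      ((mul_lt_one_of_nonneg_of_lt_one_left (Set.mem_Ioi.1 hB0).le hB2 ha1.le).trans hB1)] with t hs ht
    exact lt_of_mul_lt_mul_right ht (Real.rpow_pos_of_pos hs _).le
  · have h1 := (tendsto_const_rpow_zero_large k₁ hF.m_pos).const_mul k₂
    rw [mul_zero] at h1
    obtain ⟨B, ⟨hB1, hB2⟩, hB0⟩ := ((h1.eventually (eventually_lt_nhds one_pos)).and
      (eventually_gt_atTop (1 / a))).and (eventually_gt_atTop 0) |>.exists
    refine ⟨B, hB0, hF.flux_le_of_supersolution hB0 ha0 ?_⟩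
    filter_upwards [hF.s_pos, (hright hB0).eventually_lt (hleft B)
      (hB1.trans ((div_lt_iff₀ ha0).1 hB2))] with t hs ht
    exact lt_of_mul_lt_mul_right ht (Real.rpow_pos_of_pos hs _).le

end Subcritical

/-! ### From flux bounds to the velocity and finiteness of `α` -/

section Velocity

theorem le_velocity (hF : FluxSystem α m δ r k₁ k₂ h₁ s v σ D R H) {a : ℝ}
    (h : ∃ B, 0 < B ∧ ∀ᶠ t in rightOf α, B * s t ^ a ≤ v t) :
    ∃ C, 0 < C ∧ ∀ᶠ t in rightOf α, C * s t ^ ((a - δ) * m) ≤ σ t := by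
  obtain ⟨B, hB, h⟩ := h
  have hk := hF.k₁_pos
  refine ⟨(B / (2 * k₁)) ^ m, by positivity, ?_⟩
  filter_upwards [h, hF.s_pos, hF.D_pos, hF.σ_eq,
    hF.D_lim.eventually (eventually_lt_nhds (by linarith : k₁ < 2 * k₁))] with t hv hs hD hσ hD'
  have hsδ := Real.rpow_pos_of_pos hs δ
  have hsa := Real.rpow_pos_of_pos hs a
  rw [div_lt_iff₀ hsδ] at hD'
  rw [Real.rpow_mul hs.le, ← Real.mul_rpow (by positivity) (by positivity), hσ]
  refine Real.rpow_le_rpow (by positivity) ?_ hF.m_pos.le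
  rw [Real.rpow_sub hs, div_mul_div_comm]
  exact div_le_div₀ ((mul_pos hB hsa).le.trans hv) hv hD hD'.le

theorem velocity_le (hF : FluxSystem α m δ r k₁ k₂ h₁ s v σ D R H) {a : ℝ}
    (h : ∃ B, 0 < B ∧ ∀ᶠ t in rightOf α, v t ≤ B * s t ^ a) :
    ∃ C, 0 < C ∧ ∀ᶠ t in rightOf α, σ t ≤ C * s t ^ ((a - δ) * m) := by
  obtain ⟨B, hB, h⟩ := h
  have hk := hF.k₁_pos
  refine ⟨(B / (k₁ / 2)) ^ m, by positivity, ?_⟩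
  filter_upwards [h, hF.s_pos, hF.D_pos, hF.v_pos, hF.σ_eq,
    hF.D_lim.eventually (eventually_gt_nhds (by linarith : k₁ / 2 < k₁))]
    with t hv hs hD hv0 hσ hD'
  have hsδ := Real.rpow_pos_of_pos hs δ
  have hsa := Real.rpow_pos_of_pos hs a
  rw [lt_div_iff₀ hsδ] at hD'
  rw [Real.rpow_mul hs.le, ← Real.mul_rpow (by positivity) (by positivity), hσ]
  refine Real.rpow_le_rpow (by positivity) ?_ hF.m_pos.le
  rw [Real.rpow_sub hs, div_mul_div_comm]
  exact div_le_div₀ (by positivity) hv (by positivity) hD'.le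

theorem velocity_tendsto_zero (hF : FluxSystem α m δ r k₁ k₂ h₁ s v σ D R H) {a : ℝ}
    (ha : δ < a) (h : ∃ B, 0 < B ∧ ∀ᶠ t in rightOf α, v t ≤ B * s t ^ a) :
    Tendsto σ (rightOf α) (𝓝 0) := by
  obtain ⟨C, -, h⟩ := hF.velocity_le h
  refine squeeze_zero' ?_ h ?_
  · filter_upwards [hF.σ_eq, hF.v_pos, hF.D_pos] with t hσ hv hD
    rw [hσ]
    positivity
  · simpa using (hF.tendsto_rpow_zero (mul_pos (sub_pos.2 ha) hF.m_pos)).const_mul C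

/-- The bound gives `(s^(1-κ))' ≥ C (1-κ)`, so going backwards `s^(1-κ)` would reach zero in finite
time. -/
theorem bot_lt_of_le_velocity (hF : FluxSystem α m δ r k₁ k₂ h₁ s v σ D R H) {κ : ℝ}
    (hκ : κ < 1) (h : ∃ C, 0 < C ∧ ∀ᶠ t in rightOf α, C * s t ^ κ ≤ σ t) : ⊥ < α := by
  obtain ⟨C, hC, h⟩ := h
  rw [bot_lt_iff_ne_bot]
  intro hα
  obtain ⟨t₁, -, h₁⟩ := (eventually_rightOf_iff hF.lt_top).1
    (h.and (hF.s_pos.and hF.s_deriv))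
  have hκ' := sub_pos.2 hκ
  have hev (t : ℝ) (ht : t ≤ t₁) := h₁ t (by rw [hα]; exact EReal.bot_lt_coe t) ht
  have hmono (t : ℝ) (ht : t ≤ t₁) :
      s t ^ (1 - κ) - C * (1 - κ) * t ≤ s t₁ ^ (1 - κ) - C * (1 - κ) * t₁ := by
    refine le_of_hasDerivAt_nonneg (G := fun t => s t ^ (1 - κ) - C * (1 - κ) * t)
      (G' := fun t => σ t * (1 - κ) * s t ^ (1 - κ - 1) - C * (1 - κ) * 1) ht
      (fun x hx => ?_) (fun x hx => ?_)
    · obtain ⟨-, hs, hs'⟩ := hev x hx.2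
      exact (hs'.rpow_const (Or.inl hs.ne')).sub ((hasDerivAt_id x).const_mul _)
    · obtain ⟨hx1, hs, -⟩ := hev x hx.2.le
      have e : 1 - κ - 1 = -κ := by ring
      have hsκ := Real.rpow_pos_of_pos hs κ
      have : C ≤ σ x * s x ^ (-κ) := by
        rw [Real.rpow_neg hs.le, ← div_eq_mul_inv, le_div_iff₀ hsκ]
        exact hx1
      show 0 ≤ σ x * (1 - κ) * s x ^ (1 - κ - 1) - C * (1 - κ) * 1
      rw [e]
      nlinarith
  have hs₁ := Real.rpow_pos_of_pos (hev t₁ le_rfl).2.1 (1 - κ)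
  -- The time at which the linear bound on `s^(1-κ)` reaches zero.
  set t := t₁ - s t₁ ^ (1 - κ) / (C * (1 - κ)) with ht
  have htt : t ≤ t₁ := by rw [ht]; linarith [div_pos hs₁ (mul_pos hC hκ')]
  have hst := Real.rpow_pos_of_pos (hev t htt).2.1 (1 - κ)
  have h2 := hmono t htt
  have h3 : C * (1 - κ) * t = C * (1 - κ) * t₁ - s t₁ ^ (1 - κ) := by
    rw [ht]; field_simp
  linarith

/-- Once `s < 1`, `s' ≤ C s`, so `log s` has bounded slope and cannot tend to `-∞` in finite time.
-/
theorem not_bot_lt_of_velocity_le (hF : FluxSystem α m δ r k₁ k₂ h₁ s v σ D R H) {κ : ℝ}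
    (hκ : 1 ≤ κ) (h : ∃ C, 0 < C ∧ ∀ᶠ t in rightOf α, σ t ≤ C * s t ^ κ) : ¬ ⊥ < α := by
  obtain ⟨C, hC, h⟩ := h
  intro hα
  lift α to ℝ using ⟨hF.lt_top.ne, hα.ne'⟩
  obtain ⟨t₁, ht₁, h₁⟩ := (eventually_rightOf_iff hF.lt_top).1
    (h.and (hF.s_pos.and (hF.s_deriv.and (hF.s_lim.eventually (eventually_lt_nhds one_pos)))))
  have hlog : Tendsto (fun t => Real.log (s t)) (rightOf α) atBot :=
    Real.tendsto_log_nhdsGT_zero.comp (tendsto_nhdsWithin_iff.2 ⟨hF.s_lim, hF.s_pos⟩)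
  obtain ⟨t₂, ht₂, h₂⟩ := (eventually_rightOf_iff hF.lt_top).1
    (hlog.eventually_lt_atBot (Real.log (s t₁) - C * (t₁ - α)))
  set t := min t₁ t₂ with ht
  have htα : α < t := lt_min (EReal.coe_lt_coe_iff.1 ht₁) (EReal.coe_lt_coe_iff.1 ht₂)
  have htt₁ : t ≤ t₁ := min_le_left _ _
  have hmono : C * t - Real.log (s t) ≤ C * t₁ - Real.log (s t₁) := by
    refine le_of_hasDerivAt_nonneg (G := fun t => C * t - Real.log (s t))
      (G' := fun t => C * 1 - σ t / s t) htt₁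
      (fun x hx => ?_) (fun x hx => ?_)
    · obtain ⟨-, hs, hs', -⟩ := h₁ x (EReal.coe_lt_coe_iff.2 (htα.trans_le hx.1)) hx.2
      exact ((hasDerivAt_id x).const_mul _).sub (hs'.log hs.ne')
    · obtain ⟨hx, hs, -, hs1⟩ := h₁ x (EReal.coe_lt_coe_iff.2 (htα.trans hx.1)) hx.2.le
      have hp : s x ^ κ ≤ s x := by
        simpa using Real.rpow_le_rpow_of_exponent_ge hs hs1.le hκ
      have : σ x / s x ≤ C := by
        rw [div_le_iff₀ hs]
        exact hx.trans (mul_le_mul_of_nonneg_left hp hC.le)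
      show 0 ≤ C * 1 - σ x / s x
      linarith
  have := h₂ t (EReal.coe_lt_coe_iff.2 htα) (min_le_right _ _)
  nlinarith

theorem bot_lt_iff (hF : FluxSystem α m δ r k₁ k₂ h₁ s v σ D R H) {a : ℝ}
    (hlow : ∃ B, 0 < B ∧ ∀ᶠ t in rightOf α, B * s t ^ a ≤ v t)
    (hup : ∃ B, 0 < B ∧ ∀ᶠ t in rightOf α, v t ≤ B * s t ^ a) :
    ⊥ < α ↔ (a - δ) * m < 1 := by
  constructor
  · intro h
    by_contra! hκ
    exact hF.not_bot_lt_of_velocity_le hκ (hF.velocity_le hup) h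
  · exact fun h => hF.bot_lt_of_le_velocity h (hF.le_velocity hlow)

end Velocity

end FluxSystem

/-! ### Travelling waves: monotonicity and reduction to the flux system -/

theorem isOpen_openInterval (α β : EReal) : IsOpen (openInterval α β) :=
  (isOpen_lt continuous_const continuous_coe_real_ereal).inter
    (isOpen_lt continuous_coe_real_ereal continuous_const)

theorem eventually_mem_openInterval {α β : EReal} (h : α < β) :
    ∀ᶠ t in rightOf α, t ∈ openInterval α β := by
  obtain ⟨x, hx₁, hx₂⟩ := EReal.lt_iff_exists_real_btwn.1 h
  exact (eventually_rightOf_iff (h.trans_le le_top)).2 ⟨x, hx₁, fun t ht htx =>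
    ⟨ht, (EReal.coe_le_coe_iff.2 htx).trans_lt hx₂⟩⟩

namespace IsTravelingWave

variable {p : ℝ} {f g d ρ : ℝ → ℝ} {c : ℝ} {α β : EReal} {u : ℝ → ℝ}

theorem hasDerivAt (hu : IsTravelingWave p f g d ρ c α β u) {t : ℝ}
    (ht : t ∈ openInterval α β) : HasDerivAt u (deriv u t) t :=
  ((hu.contDiff.differentiableOn one_ne_zero).differentiableAt
    ((isOpen_openInterval α β).mem_nhds ht)).hasDerivAt

theorem flux_hasDerivAt (hu : IsTravelingWave p f g d ρ c α β u) {t : ℝ}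
    (ht : t ∈ openInterval α β) :
    HasDerivAt (pFlux p d u) (-((c * g (u t) - f (u t)) * deriv u t + ρ (u t))) t := by
  have h := ((hu.flux_contDiff.differentiableOn one_ne_zero).differentiableAt
    ((isOpen_openInterval α β).mem_nhds ht)).hasDerivAt
  have he := hu.equation t ht
  rwa [show deriv (pFlux p d u) t = -((c * g (u t) - f (u t)) * deriv u t + ρ (u t)) by
    linarith] at h

theorem deriv_pos_of_flux_pos (hS : StructuralHypotheses p f g d ρ)
    (hu : IsTravelingWave p f g d ρ c α β u) {t : ℝ} (ht : t ∈ openInterval α β)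
    (h : 0 < pFlux p d u t) : 0 < deriv u t := by
  have hd := hS.d_pos _ (hu.mem_Ioo t ht)
  have h1 := pos_of_mul_pos_right h hd.le
  exact pos_of_mul_pos_right h1 (by positivity)

/-- At a critical point the equation makes the derivative of the flux equal to `-ρ < 0`, so the flux
is positive just before it. -/
theorem eventually_flux_pos_left (hS : StructuralHypotheses p f g d ρ)
    (hu : IsTravelingWave p f g d ρ c α β u) {t : ℝ} (ht : t ∈ openInterval α β)
    (h : 0 ≤ deriv u t) : ∀ᶠ x in 𝓝[<] t, 0 < pFlux p d u x := by
  have hder := hu.flux_hasDerivAt ht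
  rcases h.eq_or_lt with h | h
  · have h0 : pFlux p d u t = 0 := by simp [pFlux, ← h]
    have hneg : -((c * g (u t) - f (u t)) * deriv u t + ρ (u t)) < 0 := by
      rw [← h]
      linarith [hS.rho_pos _ (hu.mem_Ioo t ht)]
    have hslope := (hasDerivAt_iff_tendsto_slope.1 hder).eventually (eventually_lt_nhds hneg)
    have hslope' : ∀ᶠ x in 𝓝[<] t, slope (pFlux p d u) t x < 0 :=
      nhdsWithin_mono t (fun x (hx : x < t) => hx.ne) hslope
    filter_upwards [hslope', self_mem_nhdsWithin] with x hx hxt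
    rw [slope_def_field, h0, sub_zero] at hx
    by_contra! hle
    exact absurd hx (not_lt.2 (div_nonneg_of_nonpos hle (sub_nonpos.2 (le_of_lt hxt))))
  · have hpos : 0 < pFlux p d u t := by
      have := hS.d_pos _ (hu.mem_Ioo t ht)
      have := abs_pos.2 h.ne'
      unfold pFlux
      positivity
    exact nhdsWithin_le_nhds (hder.continuousAt.eventually (eventually_gt_nhds hpos))

/-- Travelling waves are strictly decreasing. -/
theorem deriv_neg (hS : StructuralHypotheses p f g d ρ)
    (hu : IsTravelingWave p f g d ρ c α β u) {t₀ : ℝ} (ht₀ : t₀ ∈ openInterval α β) :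
    deriv u t₀ < 0 := by
  by_contra! hd0
  obtain ⟨t₁, ht₁, h₁⟩ := (eventually_rightOf_iff (hu.lt.trans_le le_top)).1
    (hu.tendsto_left.eventually (eventually_gt_nhds (hu.mem_Ioo t₀ ht₀).2))
  have ht₁₀ : t₁ < t₀ := by
    by_contra! h
    exact (h₁ t₀ ht₀.1 h).false
  have hmem : ∀ t ∈ Set.Icc t₁ t₀, t ∈ openInterval α β := fun t ht =>
    ⟨ht₁.trans_le (EReal.coe_le_coe_iff.2 ht.1), (EReal.coe_le_coe_iff.2 ht.2).trans_lt ht₀.2⟩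
  -- At the minimum point `u' ≥ 0`, so `u` is strictly increasing just to its left, contradicting
  -- minimality.
  obtain ⟨x, hx, hmin⟩ := isCompact_Icc.exists_isMinOn (Set.nonempty_Icc.2 ht₁₀.le)
    (fun t ht => (hu.hasDerivAt (hmem t ht)).continuousAt.continuousWithinAt :
      ContinuousOn u (Set.Icc t₁ t₀))
  have hx₁ : t₁ < x := by
    refine lt_of_le_of_ne hx.1 fun h => ?_
    have h2 : u x ≤ u t₀ := hmin (Set.right_mem_Icc.2 ht₁₀.le)
    have h3 := h₁ t₁ ht₁ le_rfl
    rw [h] at h3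
    linarith
  have hdx : 0 ≤ deriv u x := by
    rcases hx.2.eq_or_lt with h | h
    · rwa [h]
    · exact (hmin.isLocalMin (Icc_mem_nhds hx₁ h)).deriv_eq_zero.ge
  have hev := (eventually_flux_pos_left hS hu (hmem x hx) hdx)
  obtain ⟨y, hy, hyx⟩ := (mem_nhdsLT_iff_exists_Ioo_subset' hx₁).1 hev
  have hz₁ : max t₁ y < x := max_lt hx₁ hy
  obtain ⟨z, hz, hzx⟩ := exists_between hz₁
  have hzmem : ∀ w ∈ Set.Icc z x, w ∈ openInterval α β := fun w hw =>
    hmem w ⟨(le_max_left _ _).trans (hz.le.trans hw.1), hw.2.trans hx.2⟩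
  have hmono : StrictMonoOn u (Set.Icc z x) := by
    refine strictMonoOn_of_deriv_pos (convex_Icc z x)
      (fun w hw => (hu.hasDerivAt (hzmem w hw)).continuousAt.continuousWithinAt) fun w hw => ?_
    have hw' := hw
    rw [interior_Icc] at hw'
    exact deriv_pos_of_flux_pos hS hu (hzmem w (interior_subset hw))
      (hyx ⟨((le_max_right _ _).trans_lt hz).trans hw'.1, hw'.2⟩)
  have h2 := hmono (Set.left_mem_Icc.2 hzx.le) (Set.right_mem_Icc.2 hzx.le) hzx
  have h3 : u x ≤ u z := hmin ⟨(le_max_left _ _).trans hz.le, hzx.le.trans hx.2⟩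
  linarith

theorem tendsto_left_nhdsLT (hu : IsTravelingWave p f g d ρ c α β u) :
    Tendsto u (rightOf α) (𝓝[<] 1) :=
  tendsto_nhdsWithin_iff.2 ⟨hu.tendsto_left,
    (eventually_mem_openInterval hu.lt).mono fun t ht => (hu.mem_Ioo t ht).2⟩

theorem tendsto_div_of_isEquivalent (hu : IsTravelingWave p f g d ρ c α β u) {w : ℝ → ℝ}
    {k e : ℝ} (hk : 0 < k) (hw : w ~[𝓝[<] (1 : ℝ)] fun x => k * (1 - x) ^ e) :
    Tendsto (fun t => w (u t) / (1 - u t) ^ e) (rightOf α) (𝓝 k) := by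
  have hpos : ∀ᶠ x in 𝓝[<] (1 : ℝ), 0 < (1 - x) ^ e :=
    eventually_mem_nhdsWithin.mono fun x hx => Real.rpow_pos_of_pos (sub_pos.2 hx) e
  have h1 := (isEquivalent_iff_tendsto_one (hpos.mono fun x hx => (mul_pos hk hx).ne')).1 hw
  have h2 := (h1.const_mul k).comp hu.tendsto_left_nhdsLT
  rw [mul_one] at h2
  refine h2.congr' ((hu.tendsto_left_nhdsLT.eventually hpos).mono fun t ht => ?_)
  simp only [Function.comp_apply, Pi.div_apply]
  field_simp

theorem fluxSystem (hS : StructuralHypotheses p f g d ρ)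
    {k₁ k₂ r δ : ℝ} (hk₁ : 0 < k₁) (hk₂ : 0 < k₂) (hr : 0 < r)
    (hd : d ~[𝓝[<] (1 : ℝ)] fun u => k₁ * (1 - u) ^ δ)
    (hρ : ρ ~[𝓝[<] (1 : ℝ)] fun u => k₂ * (1 - u) ^ r)
    (hu : IsTravelingWave p f g d ρ c α β u) :
    FluxSystem α (1 / (p - 1)) δ r k₁ k₂ (c * g 1 - f 1) (fun t => 1 - u t)
      (fun t => -pFlux p d u t) (fun t => -deriv u t) (fun t => d (u t)) (fun t => ρ (u t))
      (fun t => c * g (u t) - f (u t)) := by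
  have hp := sub_pos.2 hS.one_lt_p
  have hmem := eventually_mem_openInterval hu.lt
  have hIcc : Tendsto u (rightOf α) (𝓝[Set.Icc 0 1] 1) :=
    tendsto_nhdsWithin_iff.2 ⟨hu.tendsto_left,
      hmem.mono fun t ht => Set.Ioo_subset_Icc_self (hu.mem_Ioo t ht)⟩
  have h1 : (1 : ℝ) ∈ Set.Icc (0 : ℝ) 1 := ⟨zero_le_one, le_rfl⟩
  have hflux : ∀ t ∈ openInterval α β, -pFlux p d u t = d (u t) * (-deriv u t) ^ (p - 1) := by
    intro t ht
    have hneg := deriv_neg hS hu ht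
    have e : p - 1 = (p - 2) + 1 := by ring
    rw [pFlux, abs_of_neg hneg, e, Real.rpow_add_one (neg_pos.2 hneg).ne']
    ring
  exact
    { lt_top := hu.lt.trans_le le_top
      m_pos := one_div_pos.2 hp
      k₁_pos := hk₁
      k₂_pos := hk₂
      r_pos := hr
      s_pos := hmem.mono fun t ht => sub_pos.2 (hu.mem_Ioo t ht).2
      v_pos := hmem.mono fun t ht => by
        rw [hflux t ht]
        exact mul_pos (hS.d_pos _ (hu.mem_Ioo t ht))
          (Real.rpow_pos_of_pos (neg_pos.2 (deriv_neg hS hu ht)) _)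
      D_pos := hmem.mono fun t ht => hS.d_pos _ (hu.mem_Ioo t ht)
      R_pos := hmem.mono fun t ht => hS.rho_pos _ (hu.mem_Ioo t ht)
      σ_eq := hmem.mono fun t ht => by
        rw [hflux t ht, mul_div_cancel_left₀ _ (hS.d_pos _ (hu.mem_Ioo t ht)).ne',
          ← Real.rpow_mul (neg_pos.2 (deriv_neg hS hu ht)).le, mul_one_div_cancel hp.ne',
          Real.rpow_one]
      s_deriv := hmem.mono fun t ht => (hu.hasDerivAt ht).const_sub 1
      v_deriv := hmem.mono fun t ht => by
        refine (hu.flux_hasDerivAt ht).neg.congr_deriv ?_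
        ring
      s_lim := by simpa using hu.tendsto_left.const_sub 1
      v_lim := by simpa using hu.flux_left.neg
      H_lim := (((hS.g_cont 1 h1).tendsto.comp hIcc).const_mul c).sub
        ((hS.f_cont 1 h1).tendsto.comp hIcc)
      D_lim := hu.tendsto_div_of_isEquivalent hk₁ hd
      R_lim := hu.tendsto_div_of_isEquivalent hk₂ hρ }

end IsTravelingWave

/-! ### Limits of the velocity -/

namespace FluxSystem

variable {α : EReal} {m δ r k₁ k₂ h₁ : ℝ} {s v σ D R H : ℝ → ℝ}

/-- In each regime some upper barrier has exponent larger than `δ`. -/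
theorem velocity_tendsto_zero_of_lt_one (hF : FluxSystem α m δ r k₁ k₂ h₁ s v σ D R H)
    (hint : -1 < r + δ * m) (hδ : δ < 1) : Tendsto σ (rightOf α) (𝓝 0) := by
  have hm := hF.m_pos
  have hr := hF.r_pos
  rcases lt_trichotomy (r + δ * m) m with h | h | h
  · refine hF.velocity_tendsto_zero ?_ (hF.sublinear_bounds h hint).2
    rw [lt_div_iff₀ (by linarith)]
    linarith
  · exact hF.velocity_tendsto_zero hδ (hF.linear_bounds_of_eq h).2
  · exact hF.velocity_tendsto_zero hδ ⟨|h₁| + 1, by positivity,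
      hF.flux_le_linear h (by positivity) (by linarith [neg_abs_le h₁])⟩

theorem velocity_tendsto_of_eq_one (hF : FluxSystem α m 1 r k₁ k₂ h₁ s v σ D R H) :
    Tendsto σ (rightOf α) (𝓝 ((max (-h₁) 0 / k₁) ^ m)) := by
  have h := (hF.tendsto_flux_div (by linarith [hF.r_pos])).div hF.D_lim hF.k₁_pos.ne'
  refine (h.rpow_const (Or.inr hF.m_pos.le)).congr' ?_
  filter_upwards [hF.σ_eq, hF.s_pos] with t hσ hs
  rw [hσ]
  simp only [Pi.div_apply, Real.rpow_one]
  rw [div_div_div_cancel_right₀ hs.ne']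

theorem velocity_tendsto_atTop (hF : FluxSystem α m δ r k₁ k₂ h₁ s v σ D R H)
    (hδ : 1 < δ) (hh : h₁ < 0) : Tendsto σ (rightOf α) atTop := by
  have hm := hF.m_pos
  have hlt : m < r + δ * m := by nlinarith [hF.r_pos]
  obtain ⟨C, hC, h⟩ := hF.le_velocity
    ⟨-h₁ / 2, by linarith, hF.linear_le_flux hlt (by linarith) (by linarith)⟩
  exact tendsto_atTop_mono' _ h
    ((hF.tendsto_rpow_atTop (mul_neg_of_neg_of_pos (by linarith) hm)).const_mul_atTop hC)

end FluxSystem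

/-! ### Translation of the exponents back to `p`, `δ`, `r` -/

theorem corollary6p5 (p : ℝ) (f g d ρ : ℝ → ℝ) (hS : StructuralHypotheses p f g d ρ)
    (k₁ k₂ r δ : ℝ) (hk₁ : 0 < k₁) (hk₂ : 0 < k₂) (hr : 0 < r)
    (hd : d ~[𝓝[<] (1 : ℝ)] fun u => k₁ * (1 - u) ^ δ)
    (hρ : ρ ~[𝓝[<] (1 : ℝ)] fun u => k₂ * (1 - u) ^ r)
    (hnec : 1 < r * (p - 1) + δ + p)
    (c : ℝ) (α β : EReal) (u : ℝ → ℝ) (hu : IsTravelingWave p f g d ρ c α β u) :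
    (r * (p - 1) + δ = 1 → (⊥ < α ↔ 2 < p + δ)) ∧
    (1 < r * (p - 1) + δ → c * g 1 < f 1 → (⊥ < α ↔ 2 < p + δ)) ∧
    (1 < r * (p - 1) + δ → f 1 < c * g 1 → (⊥ < α ↔ r < 1)) ∧
    (1 < r * (p - 1) + δ → c * g 1 = f 1 → r < 1 → ⊥ < α) ∧
    (r * (p - 1) + δ < 1 → (⊥ < α ↔ r + 1 < p + δ)) ∧
    (⊥ < α →
      (δ < 1 → Tendsto (deriv u) (rightOf α) (𝓝 0)) ∧
      (δ = 1 → ∃ L : ℝ, Tendsto (deriv u) (rightOf α) (𝓝 L) ∧ (L = 0 ↔ 0 ≤ c * g 1 - f 1)) ∧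
      (1 < δ → f 1 < c * g 1 → Tendsto (deriv u) (rightOf α) (𝓝 0)) ∧
      (1 < δ → c * g 1 < f 1 → Tendsto (deriv u) (rightOf α) atBot)) := by
  have hF := hu.fluxSystem hS hk₁ hk₂ hr hd hρ
  have hp : 0 < p - 1 := sub_pos.2 hS.one_lt_p
  obtain ⟨m, hm⟩ : ∃ m, m = 1 / (p - 1) := ⟨_, rfl⟩
  rw [← hm] at hF
  have hm0 : 0 < m := hF.m_pos
  have hmp : m * (p - 1) = 1 := by rw [hm]; field_simp
  have hexp : r * (p - 1) + δ = (r + δ * m) * (p - 1) := by linear_combination -δ * hmp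
  have hlt : 1 < r * (p - 1) + δ ↔ m < r + δ * m := by
    rw [← mul_lt_mul_iff_left₀ (a := p - 1) hp (b := m), hexp, hmp]
  have hgt : r * (p - 1) + δ < 1 ↔ r + δ * m < m := by
    rw [← mul_lt_mul_iff_left₀ (a := p - 1) hp (c := m), hexp, hmp]
  have heq : r * (p - 1) + δ = 1 ↔ r + δ * m = m := by
    rw [← mul_left_inj' (c := p - 1) hp.ne' (b := m), hexp, hmp]
  -- This is `hnec` divided by `p - 1`; it makes the subcritical barrier exponent positive.
  have hint : -1 < r + δ * m := by
    rw [← mul_lt_mul_iff_left₀ hp, ← hexp]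
    linarith
  have hlin : (1 - δ) * m < 1 ↔ 2 < p + δ := by
    rw [← mul_lt_mul_iff_left₀ hp, mul_assoc, hmp]
    constructor <;> intro <;> linarith
  have hbal : ((r + δ * m) / m - δ) * m = r := by field_simp; ring
  refine ⟨fun h => ?_, fun h hh => ?_, fun h hh => ?_, fun h hh hr1 => ?_, fun h => ?_, fun _ =>
    ⟨fun h => ?_, fun h => ?_, fun h hh => ?_, fun h hh => ?_⟩⟩
  · obtain ⟨hl, hu'⟩ := hF.linear_bounds_of_eq (heq.1 h)
    rw [hF.bot_lt_iff hl hu', hlin]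
  · rw [← hlin]
    exact hF.bot_lt_iff
      ⟨(f 1 - c * g 1) / 2, by linarith,
        hF.linear_le_flux (hlt.1 h) (by linarith) (by linarith)⟩
      ⟨f 1 - c * g 1 + 1, by linarith,
        hF.flux_le_linear (hlt.1 h) (by linarith) (by linarith)⟩
  · rw [hF.bot_lt_iff (hF.balance_le_flux (hlt.1 h))
      (hF.flux_le_balance (hlt.1 h) (by linarith)), hbal]
  · exact hF.bot_lt_of_le_velocity (hbal.trans_lt hr1)
      (hF.le_velocity (hF.balance_le_flux (hlt.1 h)))
  · obtain ⟨hl, hu'⟩ := hF.sublinear_bounds (hgt.1 h) hint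
    rw [hF.bot_lt_iff hl hu']
    have e : ((r + δ * m + 1) / (m + 1) - δ) * m = 1 + (r + 1 - (p + δ)) / p := by
      rw [hm]
      have : p ≠ 0 := by linarith
      field_simp
      ring
    have hp0 : 0 < p := by linarith
    rw [e, add_lt_iff_neg_left, div_neg_iff]
    constructor
    · rintro (⟨-, h'⟩ | ⟨h', -⟩) <;> linarith
    · exact fun h' => Or.inr ⟨by linarith, hp0⟩
  · simpa using (hF.velocity_tendsto_zero_of_lt_one hint h).neg
  · subst h
    refine ⟨_, by simpa using hF.velocity_tendsto_of_eq_one.neg, ?_⟩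
    rw [neg_eq_zero, Real.rpow_eq_zero (by positivity) hm0.ne', div_eq_zero_iff]
    simp [hk₁.ne']
  · have ha : δ < (r + δ * m) / m := by
      rw [lt_div_iff₀ hm0]
      linarith
    have hlt' : m < r + δ * m := by nlinarith
    simpa using (hF.velocity_tendsto_zero ha (hF.flux_le_balance hlt' (by linarith))).neg
  · have h := tendsto_neg_atTop_atBot.comp (hF.velocity_tendsto_atTop h (by linarith))
    simpa [Function.comp_def] using h
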